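/- Let $S$ and $A$ be non-empty Borel spaces (spaces homeomorphic to a Borel subset of a complete separable metric space), let $N\ge 1$, and consider a stochastic control system with state space $S$, control space $A$, disturbances in $\mathbb{R}^d$, a Borel-measurable dynamics function $f:S\times A\times\mathbb{R}^d\to S$, a Borel-measurable disturbance kernel $p(\mathrm{d}w|x,u)$ on $\mathbb{R}^d$ given $S\times A$, a Borel-measurable stage cost $c:S\times A\to\mathbb{R}$ and a Borel-measurable terminal cost $c_N:S\to\mathbb{R}$. Assume that $c$ and $c_N$ take values in $\mathcal{Z}:=[0,\bar c]$ for some real $\bar c\ge 0$, that $A$ is compact, that $f$, $c$, $c_N$ are continuous, and that $(x,u)\mapsto p(\cdot|x,u)$ is continuous for the topology of weak convergence of probability measures. A policy $\pi=(\pi_0,\dots,\pi_{N-1})\in\Pi$ is a tuple of Borel-measurable stochastic kernels $\pi_t(\mathrm{d}u|x,z)$ on $A$ given the augmented state space $S\times\mathcal{Z}$. For $x\in S$ and $\pi\in\Pi$, let $P_x^\pi$ be the law on $\Omega:=(S\times\mathcal{Z}\times A)^N\times S\times\mathcal{Z}$ of the trajectory $(x_0,z_0,u_0,\dots,x_{N-1},z_{N-1},u_{N-1},x_N,z_N)$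 with $(x_0,z_0)=(x,0)$, $u_t\sim\pi_t(\cdot|x_t,z_t)$, $w_t\sim p(\cdot|x_t,u_t)$, $x_{t+1}=f(x_t,u_t,w_t)$ and $z_{t+1}=\max\{c(x_t,u_t),z_t\}$, and let $E_x^\pi$ be the expectation with respect to $P_x^\pi$. Put $\bar Y:=\max\{c_N(x_N),\max_{0\le t<N}c(x_t,u_t)\}$. Let $s\in\mathbb{R}$, and define functions $J_t^s:S\times\mathcal{Z}\to[-\infty,+\infty]$ by $J_N^s(x,z):=\max\{\max\{c_N(x),z\}-s,0\}$ and, for $t=N-1,\dots,0$, $J_t^s(x,z):=\inf_{u\in A}v_t^s(x,z,u)$, where $v_t^s(x,z,u):=\int_{\mathbb{R}^d}J_{t+1}^s\big(f(x,u,w),\max\{c(x,u),z\}\big)\,p(\mathrm{d}w|x,u)$. Then: (1) for every $t\in\{0,\dots,N\}$, $J_t^s$ is lower semi-continuous and bounded below by $0$; (2) for every $t\in\{0,\dots,N-1\}$ there is a Borel-measurable $\kappa_t^s:S\times\mathcal{Z}\to A$ such that $J_t^s(x,z)=v_t^s(x,z,\kappa_t^s(x,z))$ for all $(x,z)\in S\times\mathcal{Z}$;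 (3) for all Borel-measurable $\kappa_0^s,\dots,\kappa_{N-1}^s$ as in (2), the policy $\bar\pi^s:=(\delta_{\kappa_0^s},\dots,\delta_{\kappa_{N-1}^s})\in\Pi$ satisfies, for all $x\in S$, $$J_0^s(x,0)=\inf_{\pi\in\Pi}E_x^\pi\big(\max\{\bar Y-s,0\}\big)=E_x^{\bar\pi^s}\big(\max\{\bar Y-s,0\}\big).$$ -/

import Mathlib

open MeasureTheory ProbabilityTheory Set

/-- The integral of an extended-real-valued function: the integral of its positive part minus the
integral of its negative part. -/
noncomputable def eintegral {Ω : Type*} [MeasurableSpace Ω] (μ : Measure Ω) (g : Ω → EReal) :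
    EReal :=
  ((∫⁻ ω, (g ω).toENNReal ∂μ : ENNReal) : EReal) - ((∫⁻ ω, (-(g ω)).toENNReal ∂μ : ENNReal) : EReal)

/-- A stochastic control system with horizon `N`, states in `S`, controls in `A` and disturbances
in `ℝ^d`, whose stage cost `c` and terminal cost `cN` take values in `[0, cbar]`. -/
structure ControlSystem (S A : Type*) [MeasurableSpace S] [MeasurableSpace A] (d : ℕ) where
  /-- the time horizon -/
  N : ℕ
  /-- the dynamics function -/
  f : S × A × EuclideanSpace ℝ (Fin d) → S
  measurable_f : Measurable f
  /-- the disturbance kernel `p(dw | x, u)` -/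
  p : Kernel (S × A) (EuclideanSpace ℝ (Fin d))
  markov_p : IsMarkovKernel p
  /-- the stage cost -/
  c : S × A → ℝ
  measurable_c : Measurable c
  /-- the terminal cost -/
  cN : S → ℝ
  measurable_cN : Measurable cN
  /-- the upper bound of the costs -/
  cbar : ℝ
  cbar_nonneg : 0 ≤ cbar
  c_mem : ∀ q, c q ∈ Icc 0 cbar
  cN_mem : ∀ x, cN x ∈ Icc 0 cbar

namespace ControlSystem

variable {S A : Type*} [MeasurableSpace S] [MeasurableSpace A] {d : ℕ} (M : ControlSystem S A d)

instance instMarkovP : IsMarkovKernel M.p := M.markov_p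

/-- The space `[0, cbar]` of values of the running maximum. -/
abbrev Z : Type := Icc (0 : ℝ) M.cbar

/-- The augmented state space `S × [0, cbar]`. -/
abbrev Aug : Type _ := S × M.Z

/-- The value `0` of the running maximum. -/
def zeroZ : M.Z := ⟨0, le_refl 0, M.cbar_nonneg⟩

/-- The update `max {c (x, u), z}` of the running maximum. -/
noncomputable def nextZ (y : M.Aug) (u : A) : M.Z :=
  ⟨max (M.c (y.1, u)) y.2, le_max_of_le_right y.2.2.1, max_le (M.c_mem _).2 y.2.2.2⟩

/-- The disturbance kernel as a map into the space of probability measures, which carries the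
topology of weak convergence. -/
noncomputable def disturbanceLaw (q : S × A) : ProbabilityMeasure (EuclideanSpace ℝ (Fin d)) :=
  ⟨M.p q, inferInstance⟩

/-! ### Value functions -/

/-- `∫ J (f (x, u, w), max {c (x, u), z}) p(dw | x, u)`. -/
noncomputable def actionValue (J : M.Aug → EReal) (y : M.Aug) (u : A) : EReal :=
  eintegral (M.p (y.1, u)) (fun w => J (M.f (y.1, u, w), M.nextZ y u))

/-- The value functions `J_t^s`, `t = 0, …, N`, defined by backward recursion from `t = N`. -/
noncomputable def J (s : ℝ) : Fin (M.N + 1) → M.Aug → EReal :=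
  Fin.reverseInduction (motive := fun _ => M.Aug → EReal)
    (fun y => ((max (max (M.cN y.1) y.2 - s) 0 : ℝ) : EReal))
    (fun _ Jnext y => ⨅ u : A, M.actionValue Jnext y u)

/-- The function `v_t^s`, `t = 0, …, N - 1`. -/
noncomputable def v (s : ℝ) (t : Fin M.N) (y : M.Aug) (u : A) : EReal :=
  M.actionValue (M.J s t.succ) y u

theorem J_last (s : ℝ) (y : M.Aug) :
    M.J s (Fin.last M.N) y = ((max (max (M.cN y.1) y.2 - s) 0 : ℝ) : EReal) := by
  simp [J]

theorem J_castSucc (s : ℝ) (t : Fin M.N) (y : M.Aug) :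
    M.J s t.castSucc y = ⨅ u : A, M.v s t y u := by
  simp [J, v]

/-! ### Policies and the law of the controlled trajectory -/

/-- The policies with `n` stages: at each stage, a stochastic kernel on `A` given the augmented
state. -/
abbrev PolicyOn (n : ℕ) : Type _ := Fin n → {k : Kernel M.Aug A // IsMarkovKernel k}

/-- The class of control policies. -/
abbrev Policy : Type _ := M.PolicyOn M.N

/-- The deterministic policy that uses the control `κ t (x_t, z_t)` at time `t`. -/
noncomputable def diracPolicy (κ : Fin M.N → M.Aug → A) (hκ : ∀ t, Measurable (κ t)) : M.Policy :=
  fun t => ⟨Kernel.deterministic (κ t) (hκ t), inferInstance⟩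

/-- The transition kernel `Q(dx' | x, u)` of the state: the law of `f (x, u, w)` when `w` has the
law `p(dw | x, u)`. -/
noncomputable def Q : Kernel (S × A) S :=
  (Kernel.id ×ₖ M.p).map (fun q => M.f (q.1.1, q.1.2, q.2))

theorem measurable_Q_map :
    Measurable (fun q : (S × A) × EuclideanSpace ℝ (Fin d) => M.f (q.1.1, q.1.2, q.2)) :=
  M.measurable_f.comp (by fun_prop)

instance instMarkovQ : IsMarkovKernel M.Q := Kernel.IsMarkovKernel.map _ M.measurable_Q_map

theorem Q_apply (x : S) (u : A) {D : Set S} (hD : MeasurableSet D) :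
    M.Q (x, u) D = M.p (x, u) {w | M.f (x, u, w) ∈ D} := by
  rw [Q, Kernel.map_apply' _ M.measurable_Q_map _ hD,
    Kernel.prod_apply' _ _ _ (M.measurable_Q_map hD), Kernel.id_apply,
    lintegral_dirac' _ (measurable_measure_prodMk_left (M.measurable_Q_map hD))]
  rfl

theorem measurable_nextZ : Measurable (fun q : M.Aug × A => M.nextZ q.1 q.2) := by
  have h : Measurable (fun q : M.Aug × A => max (M.c (q.1.1, q.2)) (q.1.2 : ℝ)) :=
    (M.measurable_c.comp (by fun_prop)).max (by fun_prop)
  exact h.subtype_mk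

/-- The transition kernel of the augmented state: the state moves according to `Q`, and the
running maximum is updated to `max {c (x, u), z}`. -/
noncomputable def augQ : Kernel (M.Aug × A) M.Aug :=
  (M.Q.comap (fun q : M.Aug × A => (q.1.1, q.2)) (by fun_prop)) ×ₖ
    Kernel.deterministic (fun q : M.Aug × A => M.nextZ q.1 q.2) M.measurable_nextZ

instance instMarkovAugQ : IsMarkovKernel M.augQ := by
  unfold augQ; infer_instance

/-- Trajectories `((x_0, z_0), u_0, …, (x_{n-1}, z_{n-1}), u_{n-1}, (x_n, z_n))` with `n`
stages. -/
abbrev TrajOn (n : ℕ) : Type _ := (Fin n → M.Aug × A) × M.Aug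

/-- The sample space. -/
abbrev Traj : Type _ := M.TrajOn M.N

/-- Puts an augmented state and a control in front of a trajectory. -/
def consTraj (n : ℕ) (q : M.Aug × ((A × M.Aug) × M.TrajOn n)) : M.TrajOn (n + 1) :=
  (Fin.cons (q.1, q.2.1.1) q.2.2.1, q.2.2.2)

theorem measurable_consTraj (n : ℕ) : Measurable (M.consTraj n) := by
  refine Measurable.prodMk (measurable_pi_lambda _ fun i => ?_) (by fun_prop)
  refine Fin.cases ?_ (fun j => ?_) i
  · simp only [Fin.cons_zero]; fun_prop
  · simp only [Fin.cons_succ]; fun_prop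

/-- The law of the trajectory with `n` stages under the policy `π`, given the initial augmented
state `y`: the control `u` is drawn from `π 0 (y)`, the next augmented state `y'` is drawn from
the transition kernel at `(y, u)`, and the rest of the trajectory is drawn from the law of the
trajectory with `n - 1` stages that starts from `y'` under the remaining part of the policy. -/
noncomputable def law : (n : ℕ) → M.PolicyOn n → Kernel M.Aug (M.TrajOn n)
  | 0, _ => Kernel.deterministic (fun y => (Fin.elim0, y)) (by fun_prop)
  | n + 1, π =>
    (Kernel.id ×ₖ (((π 0).1 ⊗ₖ M.augQ) ⊗ₖ
      ((law n (fun i => π i.succ)).comap (fun q : M.Aug × (A × M.Aug) => q.2.2)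
        (by fun_prop)))).map (M.consTraj n)

theorem isMarkovKernel_law (n : ℕ) (π : M.PolicyOn n) : IsMarkovKernel (M.law n π) := by
  induction n with
  | zero => unfold law; infer_instance
  | succ n ih =>
    have h0 := (π 0).2
    have h1 := ih (fun i => π i.succ)
    unfold law
    exact Kernel.IsMarkovKernel.map _ (M.measurable_consTraj n)

/-- The probability measure `P_x^π` on the sample space; the initial augmented state is
`(x, 0)`. -/
noncomputable def P (π : M.Policy) (x : S) : Measure M.Traj := M.law M.N π (x, M.zeroZ)

/-! ### The maximum cost and the optimal value -/

/-- The random maximum cost: the maximum of `cN (x_N)` and of all `c (x_t, u_t)`, `t < N`. -/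
noncomputable def Ybar (ω : M.Traj) : ℝ :=
  Finset.univ.fold max (M.cN ω.2.1) (fun t : Fin M.N => M.c ((ω.1 t).1.1, (ω.1 t).2))

/-- The expectation `E_x^π (max {Ybar - s, 0})`. -/
noncomputable def expectedExcess (s : ℝ) (π : M.Policy) (x : S) : EReal :=
  eintegral (M.P π x) (fun ω => ((max (M.Ybar ω - s) 0 : ℝ) : EReal))

/-- The optimal value: the infimum of the expectation over all policies. -/
noncomputable def Vbar (s : ℝ) (x : S) : EReal := ⨅ π : M.Policy, M.expectedExcess s π x

end ControlSystem

/-! The running maximum `z` carries all the past that matters: absorbing the current cost into `z`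
turns a max-cost problem into an additive-free Markov problem with only a terminal cost, so dynamic
programming applies. Everything is nonnegative and finite, so the recursion is run in `ENNReal` on
the number of stages to go (`valueToGo`).

Lower semicontinuity propagates backward: integration against a weakly continuous kernel preserves
it (`LowerSemicontinuous.lintegral_of_continuous`), and so does the infimum over the compact space
`A`. Minimizers are selected measurably by `LowerSemicontinuous.exists_measurable_argmin`. For
optimality, `policyValue_succ` says that a policy averages step values over its first control; an
average is at least the infimum, and a Dirac mass at a minimizer attains it. -/

open Filter Topology

/-! ### Infima of lower semicontinuous functions over a compact factor. -/

section Semicontinuity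

variable {X K β : Type*} [TopologicalSpace X] [TopologicalSpace K]

/-- A lower semicontinuous function on a nonempty compact space attains its infimum. -/
theorem LowerSemicontinuous.exists_eq_iInf [CompactSpace K] [Nonempty K] [CompleteLinearOrder β]
    {g : K → β} (hg : LowerSemicontinuous g) : ∃ u, g u = ⨅ u, g u := by
  obtain ⟨u, -, hu⟩ := (hg.lowerSemicontinuousOn univ).exists_isMinOn univ_nonempty isCompact_univ
  exact ⟨u, le_antisymm (le_iInf fun b => hu (mem_univ b)) (iInf_le _ u)⟩

theorem LowerSemicontinuous.comp_prodMk [Preorder β] {g : X × K → β}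
    (hg : LowerSemicontinuous g) (x : X) : LowerSemicontinuous fun u => g (x, u) :=
  hg.comp (Continuous.prodMk_right x)

/-- The partial infimum of a lower semicontinuous function over a compact factor is lower
semicontinuous. -/
theorem LowerSemicontinuous.iInf_of_compactSpace [CompactSpace K] [Nonempty K]
    [CompleteLinearOrder β] {g : X × K → β} (hg : LowerSemicontinuous g) :
    LowerSemicontinuous fun x => ⨅ u, g (x, u) := by
  intro x a ha
  have hopen : IsOpen {q : X × K | a < g q} := hg.isOpen_preimage a
  have hsub : ({x} : Set X) ×ˢ (univ : Set K) ⊆ {q : X × K | a < g q} := by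
    rintro ⟨x', u⟩ ⟨rfl, -⟩
    exact lt_of_lt_of_le ha (iInf_le _ u)
  obtain ⟨U, V, hU, -, hxU, hV, hUV⟩ :=
    generalized_tube_lemma isCompact_singleton isCompact_univ hopen hsub
  filter_upwards [hU.mem_nhds (hxU rfl)] with x' hx'
  -- Attainment of the infimum keeps the inequality strict.
  obtain ⟨u, hu⟩ := (hg.comp_prodMk x').exists_eq_iInf
  rw [← hu]
  exact hUV (show (x', u) ∈ U ×ˢ V from ⟨hx', hV (mem_univ u)⟩)

end Semicontinuity

/-! ### Measurable selection of minimizers. -/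

section Selection

variable {Y A : Type*} [TopologicalSpace Y] [MeasurableSpace Y] [OpensMeasurableSpace Y]
  [TopologicalSpace A] [CompactSpace A] [TopologicalSpace.MetrizableSpace A]
  [MeasurableSpace A] [BorelSpace A] [Nonempty A]

/-- A lower semicontinuous function on a product with a compact metrizable factor has a Borel
measurable selection of minimizers. -/
theorem LowerSemicontinuous.exists_measurable_argmin {g : Y × A → ENNReal}
    (hg : LowerSemicontinuous g) :
    ∃ κ : Y → A, Measurable κ ∧ ∀ y, g (y, κ y) = ⨅ u, g (y, u) := by
  let _ : MetricSpace A := TopologicalSpace.metrizableSpaceMetric A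
  -- Parametrizing `A` by the Cantor set, a compact subset of `ℝ`, provides a linear order, so the
  -- least minimizing parameter is a canonical choice.
  obtain ⟨φ₀, hφ₀, hsurj₀⟩ := exists_nat_bool_continuous_surjective_of_compact A
  obtain ⟨φ, hφ, hsurj⟩ : ∃ φ : cantorSet → A, Continuous φ ∧ Function.Surjective φ :=
    ⟨φ₀ ∘ cantorSetHomeomorphNatToBool, hφ₀.comp (Homeomorph.continuous _),
      hsurj₀.comp (Homeomorph.surjective _)⟩
  have : CompactSpace cantorSet := isCompact_iff_compactSpace.1 isCompact_cantorSet
  have hJ : Measurable fun y => ⨅ u, g (y, u) := hg.iInf_of_compactSpace.measurable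
  have hgφ : LowerSemicontinuous fun q : Y × cantorSet => g (q.1, φ q.2) :=
    hg.comp (continuous_fst.prodMk (hφ.comp continuous_snd))
  have hleast : ∀ y, ∃ r, IsLeast {r : cantorSet | g (y, φ r) ≤ ⨅ u, g (y, u)} r := by
    intro y
    refine IsCompact.exists_isLeast
      (((hgφ.comp_prodMk y).isClosed_preimage (⨅ u, g (y, u))).isCompact) ?_
    obtain ⟨u, hu⟩ := (hg.comp_prodMk y).exists_eq_iInf
    obtain ⟨r, rfl⟩ := hsurj u
    exact ⟨r, hu.le⟩
  choose r hr using hleast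
  have hr_meas : Measurable fun y => (r y : ℝ) := by
    -- `r y ≤ t` holds iff the infimum over parameters `≤ t` does not exceed the full infimum; both
    -- are lower semicontinuous in `y`, hence Borel.
    refine measurable_of_Iic fun t => ?_
    let K : Set cantorSet := {a | (a : ℝ) ≤ t}
    have hK : IsClosed K := isClosed_le continuous_subtype_val continuous_const
    have : CompactSpace K := isCompact_iff_compactSpace.1 hK.isCompact
    rcases isEmpty_or_nonempty K with hE | hne
    · convert MeasurableSet.empty
      ext y
      simp only [mem_preimage, mem_Iic, mem_empty_iff_false, iff_false]
      exact fun h => hE.false ⟨r y, h⟩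
    · have hgK : LowerSemicontinuous fun q : Y × K => g (q.1, φ q.2) :=
        hgφ.comp (continuous_fst.prodMk (continuous_subtype_val.comp continuous_snd))
      convert measurableSet_le hgK.iInf_of_compactSpace.measurable hJ using 1
      ext y
      simp only [mem_preimage, mem_Iic, mem_ofPred_eq]
      constructor
      · intro h
        exact (iInf_le (fun a : K => g (y, φ a)) ⟨r y, h⟩).trans (hr y).1
      · intro h
        obtain ⟨a, ha⟩ := (hgK.comp_prodMk y).exists_eq_iInf
        exact le_trans ((hr y).2 (show g (y, φ a) ≤ _ from ha.le.trans h)) a.2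
  refine ⟨fun y => φ (r y), hφ.measurable.comp (hr_meas.subtype_mk (h := fun y => (r y).2)),
    fun y => le_antisymm (hr y).1 (iInf_le _ _)⟩

end Selection

/-! ### Lower semicontinuity of integrals under weak convergence. -/

section WeakConvergence

/-- The portmanteau theorem for nonnegative, finite lower semicontinuous functions. -/
theorem MeasureTheory.ProbabilityMeasure.lintegral_le_liminf_of_tendsto {Ω : Type*}
    [TopologicalSpace Ω] [MeasurableSpace Ω] [OpensMeasurableSpace Ω] [HasOuterApproxClosed Ω]
    {ν : ProbabilityMeasure Ω} {νs : ℕ → ProbabilityMeasure Ω} (h : Tendsto νs atTop (𝓝 ν))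
    {g : Ω → ENNReal} (hg : LowerSemicontinuous g) (hfin : ∀ ω, g ω ≠ ⊤) :
    ∫⁻ ω, g ω ∂(ν : Measure Ω) ≤ liminf (fun n => ∫⁻ ω, g ω ∂(νs n : Measure Ω)) atTop := by
  -- The layer-cake formula reduces the claim to the open superlevel sets, then Fatou applies.
  -- Finiteness matters since `toReal` sends `⊤` to `0`.
  have hlayer : ∀ μ : Measure Ω,
      ∫⁻ ω, g ω ∂μ = ∫⁻ t in Ioi (0 : ℝ), μ {ω | t < (g ω).toReal} := by
    intro μ
    rw [← lintegral_eq_lintegral_meas_lt μ (Eventually.of_forall fun _ => ENNReal.toReal_nonneg)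
      hg.measurable.ennreal_toReal.aemeasurable]
    exact lintegral_congr fun ω => (ENNReal.ofReal_toReal (hfin ω)).symm
  simp only [hlayer]
  have hanti : ∀ μ : Measure Ω, Measurable fun t : ℝ => μ {ω | t < (g ω).toReal} := fun μ =>
    Antitone.measurable fun a b hab => measure_mono fun ω (hω : b < _) => lt_of_le_of_lt hab hω
  refine le_trans (setLIntegral_mono (Measurable.liminf fun n => hanti (νs n : Measure Ω))
    fun t ht => ?_) (lintegral_liminf_le fun n => hanti (νs n : Measure Ω))
  refine ProbabilityMeasure.le_liminf_measure_open_of_tendsto h ?_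
  have : {ω | t < (g ω).toReal} = g ⁻¹' Ioi (ENNReal.ofReal t) := by
    ext ω
    exact (ENNReal.ofReal_lt_iff_lt_toReal (le_of_lt ht) (hfin ω)).symm
  rw [this]
  exact hg.isOpen_preimage _

/-- If `x ↦ μ x` is weakly continuous, then integrating a nonnegative, finite lower semicontinuous
function of `(x, w)` against `μ x` yields a lower semicontinuous function of `x`. -/
theorem LowerSemicontinuous.lintegral_of_continuous {X W : Type*}
    [TopologicalSpace X] [TopologicalSpace.MetrizableSpace X] [SecondCountableTopology X]
    [MeasurableSpace X] [BorelSpace X]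
    [TopologicalSpace W] [TopologicalSpace.MetrizableSpace W] [SecondCountableTopology W]
    [MeasurableSpace W] [BorelSpace W]
    {μ : X → ProbabilityMeasure W} (hμ : Continuous μ)
    {g : X × W → ENNReal} (hg : LowerSemicontinuous g) (hfin : ∀ q, g q ≠ ⊤) :
    LowerSemicontinuous fun x => ∫⁻ w, g (x, w) ∂(μ x : Measure W) := by
  let _ : MetricSpace X := TopologicalSpace.metrizableSpaceMetric X
  let _ : MetricSpace W := TopologicalSpace.metrizableSpaceMetric W
  -- The Dirac factor moves the dependence on `x` from the integrand into the measure.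
  let ν : X → ProbabilityMeasure (X × W) := fun x => (diracProba x).prod (μ x)
  have hν : Continuous ν :=
    ProbabilityMeasure.continuous_prod.comp (continuous_diracProba.prodMk hμ)
  have hint : ∀ x, ∫⁻ w, g (x, w) ∂(μ x : Measure W) = ∫⁻ q, g q ∂(ν x : Measure (X × W)) := by
    intro x
    change _ = ∫⁻ q, g q ∂((Measure.dirac x).prod (μ x : Measure W))
    rw [Measure.dirac_prod, lintegral_map hg.measurable (by fun_prop)]
  simp only [hint]
  intro x a ha
  by_contra hcon
  obtain ⟨xs, hxs, hle⟩ := exists_seq_forall_of_frequently (not_eventually.1 hcon)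
  refine absurd (ProbabilityMeasure.lintegral_le_liminf_of_tendsto
    ((hν.tendsto x).comp hxs) hg hfin) (not_le.2 (lt_of_le_of_lt ?_ ha))
  refine (liminf_le_liminf (v := fun _ => a)
    (Eventually.of_forall fun n => not_lt.1 (hle n))).trans ?_
  simp

end WeakConvergence
-- The value recursion in `ENNReal`.
theorem eintegral_coe_ennreal {Ω : Type*} [MeasurableSpace Ω] (μ : Measure Ω) (h : Ω → ENNReal) :
    eintegral μ (fun ω => (h ω : EReal)) = ((∫⁻ ω, h ω ∂μ : ENNReal) : EReal) := by
  have hneg : ∀ ω, (-(h ω : EReal)).toENNReal = 0 := fun ω =>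
    EReal.toENNReal_of_nonpos (by simpa using EReal.coe_ennreal_nonneg (h ω))
  simp only [eintegral, EReal.toENNReal_coe, hneg, lintegral_zero]
  simp

theorem EReal.coe_ennreal_iInf {ι : Sort*} [Nonempty ι] (h : ι → ENNReal) :
    ((⨅ i, h i : ENNReal) : EReal) = ⨅ i, (h i : EReal) :=
  Monotone.map_ciInf_of_continuousAt continuous_coe_ennreal_ereal.continuousAt
    EReal.coe_ennreal_strictMono.monotone (OrderBot.bddBelow _)

namespace ControlSystem

variable {S A : Type*} [MeasurableSpace S] [MeasurableSpace A] {d : ℕ} (M : ControlSystem S A d)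

/-- The expected value of `F` at the next augmented state, when the control `u` is used in the
augmented state `y`. -/
noncomputable def stepValue (F : M.Aug → ENNReal) (y : M.Aug) (u : A) : ENNReal :=
  ∫⁻ w, F (M.f (y.1, u, w), M.nextZ y u) ∂(M.p (y.1, u))

/-- The optimal expected excess of the maximum cost over `s` with `n` stages to go. -/
noncomputable def valueToGo (s : ℝ) : ℕ → M.Aug → ENNReal
  | 0 => fun y => ENNReal.ofReal (max (max (M.cN y.1) y.2 - s) 0)
  | n + 1 => fun y => ⨅ u : A, M.stepValue (valueToGo s n) y u

theorem actionValue_coe (F : M.Aug → ENNReal) (y : M.Aug) (u : A) :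
    M.actionValue (fun y => (F y : EReal)) y u = (M.stepValue F y u : EReal) :=
  eintegral_coe_ennreal _ _

theorem J_eq_valueToGo [Nonempty A] (s : ℝ) (t : Fin (M.N + 1)) :
    M.J s t = fun y => (M.valueToGo s t.rev y : EReal) := by
  induction t using Fin.reverseInduction with
  | last =>
    funext y
    simp [J_last, valueToGo, EReal.coe_ennreal_ofReal]
  | cast t ih =>
    funext y
    have hrev : (t.castSucc.rev : ℕ) = t.succ.rev + 1 := by
      simp only [Fin.val_rev, Fin.val_castSucc, Fin.val_succ]; omega
    rw [J_castSucc, hrev, valueToGo, EReal.coe_ennreal_iInf]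
    refine iInf_congr fun u => ?_
    rw [v, ih, actionValue_coe]

theorem v_eq_stepValue [Nonempty A] (s : ℝ) (t : Fin M.N) (y : M.Aug) (u : A) :
    M.v s t y u = (M.stepValue (M.valueToGo s t.rev) y u : EReal) := by
  have hrev : (t.succ.rev : ℕ) = t.rev := by
    simp only [Fin.val_rev, Fin.val_succ]; omega
  rw [v, J_eq_valueToGo, actionValue_coe, hrev]

theorem J_castSucc_eq_valueToGo [Nonempty A] (s : ℝ) (t : Fin M.N) (y : M.Aug) :
    M.J s t.castSucc y = (M.valueToGo s (t.rev + 1) y : EReal) := by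
  have hrev : (t.castSucc.rev : ℕ) = t.rev + 1 := by
    simp only [Fin.val_rev, Fin.val_castSucc]; omega
  rw [J_eq_valueToGo, hrev]

/-- The bound `max (cbar - s) 0` survives integration against probability measures. Finiteness is
what the portmanteau argument requires. -/
theorem valueToGo_lt_top [Nonempty A] (s : ℝ) (n : ℕ) (y : M.Aug) : M.valueToGo s n y < ⊤ := by
  have key : ∀ y, M.valueToGo s n y ≤ ENNReal.ofReal (max (M.cbar - s) 0) := by
    induction n with
    | zero =>
      intro y
      refine ENNReal.ofReal_le_ofReal (max_le_max_right _ (sub_le_sub_right ?_ _))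
      exact max_le (M.cN_mem _).2 y.2.2.2
    | succ n ih =>
      intro y
      refine (iInf_le _ (Classical.arbitrary A)).trans ?_
      refine (lintegral_mono fun w => ih _).trans ?_
      simp
  exact (key y).trans_lt ENNReal.ofReal_lt_top

section Topological

variable [TopologicalSpace S] [TopologicalSpace A] {M}

theorem continuous_nextZ (hc : Continuous M.c) :
    Continuous fun q : M.Aug × A => M.nextZ q.1 q.2 := by
  have h : Continuous fun q : M.Aug × A => max (M.c (q.1.1, q.2)) (q.1.2 : ℝ) :=
    (hc.comp (by fun_prop)).max (by fun_prop)
  exact h.subtype_mk _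

variable [TopologicalSpace.MetrizableSpace S] [SecondCountableTopology S] [BorelSpace S]
  [TopologicalSpace.MetrizableSpace A] [SecondCountableTopology A] [BorelSpace A]

theorem lowerSemicontinuous_stepValue (hf : Continuous M.f) (hc : Continuous M.c)
    (hp : Continuous M.disturbanceLaw) {F : M.Aug → ENNReal} (hF : LowerSemicontinuous F)
    (hfin : ∀ y, F y ≠ ⊤) :
    LowerSemicontinuous fun q : M.Aug × A => M.stepValue F q.1 q.2 := by
  have hg : LowerSemicontinuous fun r : (M.Aug × A) × EuclideanSpace ℝ (Fin d) =>
      F (M.f (r.1.1.1, r.1.2, r.2), M.nextZ r.1.1 r.1.2) :=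
    hF.comp ((hf.comp (by fun_prop)).prodMk ((continuous_nextZ hc).comp continuous_fst))
  have hμ : Continuous fun q : M.Aug × A => M.disturbanceLaw (q.1.1, q.2) :=
    hp.comp (by fun_prop)
  exact hg.lintegral_of_continuous hμ fun _ => hfin _

theorem lowerSemicontinuous_valueToGo [CompactSpace A] [Nonempty A] (hf : Continuous M.f)
    (hc : Continuous M.c) (hcN : Continuous M.cN) (hp : Continuous M.disturbanceLaw) (s : ℝ)
    (n : ℕ) : LowerSemicontinuous (M.valueToGo s n) := by
  induction n with
  | zero =>
    refine Continuous.lowerSemicontinuous (ENNReal.continuous_ofReal.comp ?_)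
    exact (((hcN.comp continuous_fst).max (by fun_prop)).sub continuous_const).max
      continuous_const
  | succ n ih =>
    exact (lowerSemicontinuous_stepValue hf hc hp ih
      fun y => (M.valueToGo_lt_top s n y).ne).iInf_of_compactSpace

end Topological

/-! ### Costs of policies and optimality. -/

/-- The maximum cost along a trajectory with `n` stages. -/
noncomputable def maxCost (n : ℕ) (ω : M.TrajOn n) : ℝ :=
  Finset.univ.fold max (M.cN ω.2.1) (fun t : Fin n => M.c ((ω.1 t).1.1, (ω.1 t).2))

theorem maxCost_consTraj (n : ℕ) (y : M.Aug) (u : A) (y' : M.Aug) (ω : M.TrajOn n) :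
    M.maxCost (n + 1) (M.consTraj n (y, (u, y'), ω)) = max (M.c (y.1, u)) (M.maxCost n ω) := by
  simp [maxCost, consTraj, Fin.univ_succ, Finset.fold_map]

theorem maxCost_nonneg (n : ℕ) (ω : M.TrajOn n) : 0 ≤ M.maxCost n ω :=
  (Finset.le_fold_max _).2 (Or.inl (M.cN_mem _).1)

theorem measurable_maxCost (n : ℕ) : Measurable (M.maxCost n) := by
  have key : ∀ T : Finset (Fin n), Measurable fun ω : M.TrajOn n =>
      T.fold max (M.cN ω.2.1) (fun t => M.c ((ω.1 t).1.1, (ω.1 t).2)) := by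
    intro T
    induction T using Finset.cons_induction with
    | empty => exact M.measurable_cN.comp (by fun_prop)
    | cons t T ht ih =>
      simp only [Finset.fold_cons]
      exact (M.measurable_c.comp (by fun_prop)).max ih
  exact key Finset.univ

/-- The excess over `s` of the maximum of `z` and the maximum cost along a trajectory. -/
noncomputable def excess (s : ℝ) (n : ℕ) (z : ℝ) (ω : M.TrajOn n) : ENNReal :=
  ENNReal.ofReal (max (max (M.maxCost n ω) z - s) 0)

theorem measurable_excess (s : ℝ) (n : ℕ) {X : Type*} [MeasurableSpace X] {ζ : X → ℝ}
    (hζ : Measurable ζ) {τ : X → M.TrajOn n} (hτ : Measurable τ) :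
    Measurable fun x => M.excess s n (ζ x) (τ x) :=
  (((((M.measurable_maxCost n).comp hτ).max hζ).sub_const s).max measurable_const).ennreal_ofReal

/-- Associativity of `max` lets the first cost pass into the running maximum; this is why the state
is augmented. -/
theorem excess_consTraj (s : ℝ) (n : ℕ) (y : M.Aug) (r : A × M.Aug) (ω : M.TrajOn n) :
    M.excess s (n + 1) y.2 (M.consTraj n (y, r, ω)) = M.excess s n (M.nextZ y r.1) ω := by
  obtain ⟨u, y'⟩ := r
  rw [excess, maxCost_consTraj, excess, nextZ]
  simp only [max_left_comm, max_comm]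

theorem lintegral_augQ (y : M.Aug) (u : A) {F : M.Aug → ENNReal} (hF : Measurable F) :
    ∫⁻ y', F y' ∂(M.augQ (y, u)) = M.stepValue F y u := by
  have hFz : Measurable fun x' => F (x', M.nextZ y u) := hF.comp measurable_prodMk_right
  have hFQ : Measurable fun q : (S × A) × EuclideanSpace ℝ (Fin d) =>
      F (M.f (q.1.1, q.1.2, q.2), M.nextZ y u) := hFz.comp M.measurable_Q_map
  rw [augQ, Kernel.lintegral_prod_deterministic _ _ _ hF, Kernel.comap_apply, Q,
    Kernel.lintegral_map _ M.measurable_Q_map _ hFz, Kernel.lintegral_id_prod hFQ]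
  rfl

/-- The expected excess with `n` stages to go under the policy `π`. -/
noncomputable def policyValue (s : ℝ) (n : ℕ) (π : M.PolicyOn n) (y : M.Aug) : ENNReal :=
  ∫⁻ ω, M.excess s n y.2 ω ∂(M.law n π y)

theorem policyValue_zero (s : ℝ) (π : M.PolicyOn 0) (y : M.Aug) :
    M.policyValue s 0 π y = M.valueToGo s 0 y := by
  have h : Measurable fun ω => M.excess s 0 y.2 ω :=
    M.measurable_excess s 0 measurable_const measurable_id
  rw [policyValue, law, Kernel.deterministic_apply, lintegral_dirac' _ h]
  simp [excess, maxCost, valueToGo]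

theorem policyValue_succ (s : ℝ) (n : ℕ) (π : M.PolicyOn (n + 1)) (y : M.Aug) :
    M.policyValue s (n + 1) π y =
      ∫⁻ u, M.stepValue (M.policyValue s n fun i => π i.succ) y u ∂((π 0).1 y) := by
  have h0 := (π 0).2
  have h1 := M.isMarkovKernel_law n (fun i => π i.succ)
  have hexc : Measurable fun ω => M.excess s (n + 1) y.2 ω :=
    M.measurable_excess s (n + 1) measurable_const measurable_id
  have hcons : Measurable fun q => M.excess s (n + 1) y.2 (M.consTraj n q) :=
    hexc.comp (M.measurable_consTraj n)
  have hcons' : Measurable fun r => M.excess s (n + 1) y.2 (M.consTraj n (y, r)) :=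
    hcons.comp measurable_prodMk_left
  rw [policyValue, law, Kernel.lintegral_map _ (M.measurable_consTraj n) _ hexc,
    Kernel.lintegral_id_prod hcons, Kernel.lintegral_compProd _ _ _ hcons']
  have hinner : Measurable fun r : A × M.Aug =>
      ∫⁻ ω, M.excess s n (M.nextZ y r.1) ω ∂(M.law n (fun i => π i.succ) r.2) := by
    have hz : Measurable fun r : A × M.Aug => (M.nextZ y r.1 : ℝ) :=
      measurable_subtype_coe.comp
        (M.measurable_nextZ.comp (measurable_const.prodMk measurable_fst))
    have h : Measurable fun q : (A × M.Aug) × M.TrajOn n =>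
        M.excess s n (M.nextZ y q.1.1) q.2 :=
      M.measurable_excess s n (hz.comp measurable_fst) measurable_snd
    exact h.lintegral_kernel_prod_right' (κ := (M.law n fun i => π i.succ).comap
      (fun r : A × M.Aug => r.2) measurable_snd)
  simp only [excess_consTraj, Kernel.comap_apply]
  rw [Kernel.lintegral_compProd _ _ _ hinner]
  refine lintegral_congr fun u => ?_
  -- `stepValue` only visits states whose second coordinate is `nextZ y u`, so the frozen maximum in
  -- the integrand is the one `policyValue` uses.
  exact M.lintegral_augQ y u (hinner.comp measurable_prodMk_left)

theorem stepValue_mono {F G : M.Aug → ENNReal} (h : ∀ y, F y ≤ G y) (y : M.Aug) (u : A) :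
    M.stepValue F y u ≤ M.stepValue G y u :=
  lintegral_mono fun _ => h _

theorem valueToGo_le_policyValue (s : ℝ) (n : ℕ) (π : M.PolicyOn n) (y : M.Aug) :
    M.valueToGo s n y ≤ M.policyValue s n π y := by
  induction n generalizing y with
  | zero => rw [policyValue_zero]
  | succ n ih =>
    have h0 := (π 0).2
    rw [policyValue_succ]
    calc M.valueToGo s (n + 1) y
        = ∫⁻ _, M.valueToGo s (n + 1) y ∂((π 0).1 y) := by simp
      _ ≤ _ := lintegral_mono fun u => (iInf_le _ u).trans
          (M.stepValue_mono (fun y' => ih (fun i => π i.succ) y') y u)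

theorem policyValue_deterministic [MeasurableSingletonClass A] (s : ℝ) (n : ℕ) (κ : Fin n → M.Aug → A)
    (hκ : ∀ t, Measurable (κ t))
    (hopt : ∀ t y, M.valueToGo s (t.rev + 1) y = M.stepValue (M.valueToGo s t.rev) y (κ t y))
    (y : M.Aug) :
    M.policyValue s n (fun t => ⟨Kernel.deterministic (κ t) (hκ t), inferInstance⟩) y =
      M.valueToGo s n y := by
  induction n generalizing y with
  | zero => rw [policyValue_zero]
  | succ n ih =>
    have hih : M.policyValue s n
        (fun t => ⟨Kernel.deterministic (κ t.succ) (hκ t.succ), inferInstance⟩) =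
        M.valueToGo s n := by
      refine funext fun y => ih (fun t => κ t.succ) (fun t => hκ t.succ) (fun t y => ?_) y
      -- Stage `t` of the tail is stage `t.succ` of the whole, with equally many stages to go.
      have := hopt t.succ y
      rwa [Fin.rev_succ, Fin.val_castSucc] at this
    have h0 := hopt 0 y
    rw [Fin.rev_zero, Fin.val_last] at h0
    rw [policyValue_succ, hih, h0, Kernel.deterministic_apply,
      lintegral_dirac]

theorem expectedExcess_eq_policyValue (s : ℝ) (π : M.Policy) (x : S) :
    M.expectedExcess s π x = (M.policyValue s M.N π (x, M.zeroZ) : EReal) := by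
  rw [policyValue, ← eintegral_coe_ennreal]
  refine congrArg (eintegral (M.P π x)) (funext fun ω => ?_)
  -- Since costs are nonnegative, starting the running maximum at `0` changes nothing.
  have : M.Ybar ω = max (M.maxCost M.N ω) (M.zeroZ : ℝ) :=
    (max_eq_left (M.maxCost_nonneg M.N ω)).symm
  rw [excess, this, EReal.coe_ennreal_ofReal, max_eq_left (le_max_right _ (0 : ℝ))]

end ControlSystem

theorem theorem1 {S A : Type*}
    [TopologicalSpace S] [TopologicalSpace.MetrizableSpace S] [SecondCountableTopology S]
    [MeasurableSpace S] [BorelSpace S] [StandardBorelSpace S] [Nonempty S]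
    [TopologicalSpace A] [TopologicalSpace.MetrizableSpace A] [SecondCountableTopology A]
    [MeasurableSpace A] [BorelSpace A] [StandardBorelSpace A] [Nonempty A]
    {d : ℕ} (M : ControlSystem S A d)
    [CompactSpace A]
    (hf : Continuous M.f) (hc : Continuous M.c) (hcN : Continuous M.cN)
    (hp : Continuous M.disturbanceLaw)
    (s : ℝ) :
    (∀ t : Fin (M.N + 1), LowerSemicontinuous (M.J s t) ∧ ∀ y, 0 ≤ M.J s t y) ∧
    (∀ t : Fin M.N, ∃ κ : M.Aug → A, Measurable κ ∧
      ∀ y, M.J s t.castSucc y = M.v s t y (κ y)) ∧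
    (∀ (κ : Fin M.N → M.Aug → A) (hκ : ∀ t, Measurable (κ t)),
      (∀ t y, M.J s t.castSucc y = M.v s t y (κ t y)) →
      ∀ x : S, M.J s 0 (x, M.zeroZ) = M.Vbar s x ∧
        M.Vbar s x = M.expectedExcess s (M.diracPolicy κ hκ) x) := by
  have hstep : ∀ n, LowerSemicontinuous fun q : M.Aug × A =>
      M.stepValue (M.valueToGo s n) q.1 q.2 := fun n =>
    ControlSystem.lowerSemicontinuous_stepValue hf hc hp
      (ControlSystem.lowerSemicontinuous_valueToGo hf hc hcN hp s n)
      fun y => (M.valueToGo_lt_top s n y).ne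
  refine ⟨fun t => ?_, fun t => ?_, fun κ hκ hopt x => ?_⟩
  · rw [M.J_eq_valueToGo]
    refine ⟨?_, fun y => EReal.coe_ennreal_nonneg _⟩
    exact continuous_coe_ennreal_ereal.comp_lowerSemicontinuous
      (ControlSystem.lowerSemicontinuous_valueToGo hf hc hcN hp s _)
      EReal.coe_ennreal_strictMono.monotone
  · obtain ⟨κ, hκ, hmin⟩ := (hstep t.rev).exists_measurable_argmin
    refine ⟨κ, hκ, fun y => ?_⟩
    rw [M.J_castSucc_eq_valueToGo, M.v_eq_stepValue]
    exact congrArg _ (hmin y).symm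
  · have hJ : M.J s 0 (x, M.zeroZ) = (M.valueToGo s M.N (x, M.zeroZ) : EReal) := by
      rw [M.J_eq_valueToGo, Fin.rev_zero, Fin.val_last]
    have hκJ : M.expectedExcess s (M.diracPolicy κ hκ) x = M.J s 0 (x, M.zeroZ) := by
      rw [M.expectedExcess_eq_policyValue, hJ]
      refine congrArg _ (M.policyValue_deterministic s M.N κ hκ (fun t y => ?_) _)
      have h := hopt t y
      rwa [M.J_castSucc_eq_valueToGo, M.v_eq_stepValue, EReal.coe_ennreal_eq_coe_ennreal_iff] at h
    have hle : M.J s 0 (x, M.zeroZ) ≤ M.Vbar s x := by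
      refine le_iInf fun π => ?_
      rw [M.expectedExcess_eq_policyValue, hJ]
      exact EReal.coe_ennreal_le_coe_ennreal_iff.2 (M.valueToGo_le_policyValue s M.N π _)
    have heq : M.J s 0 (x, M.zeroZ) = M.Vbar s x :=
      le_antisymm hle ((iInf_le _ (M.diracPolicy κ hκ)).trans hκJ.le)
    exact ⟨heq, heq.symm.trans hκJ.symm⟩
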